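/- All graphs are finite and simple. A graph is \emph{prolific} if it is connected and is not isomorphic to a path $P_k$ ($k\ge 1$), a cycle $C_k$ ($k\ge 3$) or the star $K_{1,3}$; let $\mathcal F$ be the family of all prolific graphs. The line graph $L(G)$ has vertex set $E(G)$, two edges of $G$ being adjacent in $L(G)$ if they are distinct and share an endpoint; put $L^0(G)=G$ and $L^{k}(G)=L(L^{k-1}(G))$ for $k\ge 1$. Let $\mu(G)$ be the matching number of $G$ (the largest number of edges in a matching), let $\mathrm{ind}(\mu,G)=\min\{r : \mu(G)<\mu(L^r(G))\}$, and let $k(\mu,\mathcal F)=\max\{\mathrm{ind}(\mu,G) : G\in\mathcal F\}$ (in both cases $\infty$ if there is no such number). A subdivision of $K_{1,3}$ consists of three paths with $m_1,m_2,m_3\ge 1$ edges that share one end vertex, the centre, and are otherwise disjoint; it is of \emph{type A} (respectively \emph{type B}) if exactly two (respectively exactly one) of the neighbours of the centre are leaves. For type B the paths are labelled so that $m_1\ge m_2>m_3=1$. \textbf{Theorem.} Let $G$ be a prolific graph on $n$ vertices. Then $\mathrm{ind}(\mu,G)\le 4$. Moreover, $\mathrm{ind}(\mu,G)=4$ if and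 only if either $n$ is odd and $G$ is a type A subdivision of $K_{1,3}$, or $n$ is even and $G$ is a type B subdivision of $K_{1,3}$ with $m_1$ and $m_2$ even. Hence $k(\mu,\mathcal F)=4$. -/

import Mathlib

universe u

/-- A graph together with its vertex type. -/
abbrev AnyGraph : Type (u + 1) := Σ V : Type u, SimpleGraph V

/-- The line graph. -/
def AnyGraph.line (X : AnyGraph.{u}) : AnyGraph.{u} := ⟨X.2.edgeSet, X.2.lineGraph⟩

/-- The iterated line graph: `L^0(G) = G` and `L^(k+1)(G) = L(L^k(G))`. -/
def AnyGraph.iterLine : ℕ → AnyGraph.{u} → AnyGraph.{u}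
  | 0, X => X
  | k + 1, X => (AnyGraph.iterLine k X).line

/-- A prolific graph: a finite connected simple graph that is not isomorphic to a path, a cycle or
the star `K_{1,3}`. -/
def IsProlific (X : AnyGraph.{u}) : Prop :=
  Finite X.1 ∧ X.2.Connected ∧
    (∀ k : ℕ, ¬ Nonempty (X.2 ≃g SimpleGraph.pathGraph k)) ∧
    (∀ k : ℕ, 3 ≤ k → ¬ Nonempty (X.2 ≃g SimpleGraph.cycleGraph k)) ∧
    ¬ Nonempty (X.2 ≃g completeBipartiteGraph (Fin 1) (Fin 3))

/-- The matching number: the largest number of edges of a matching. -/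
noncomputable def matchingNumber (X : AnyGraph.{u}) : ℕ∞ :=
  ⨆ M : {M : X.2.Subgraph // M.IsMatching}, M.1.edgeSet.encard

/-- `ind(P, G) = min {r : P(G) < P(L^r(G))}`, with value `⊤` if there is no such `r`. -/
noncomputable def paramIndex (P : AnyGraph.{u} → ℕ∞) (X : AnyGraph.{u}) : ℕ∞ :=
  ⨅ (r : ℕ) (_ : P X < P (AnyGraph.iterLine r X)), (r : ℕ∞)

/-- `k(P, F) = max {ind(P, G) : G ∈ F}`, with value `⊤` if the indices are not bounded. For a
nonempty family a finite supremum in `ℕ∞` is attained, so it is a maximum. -/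
noncomputable def familyIndex (P : AnyGraph.{u} → ℕ∞) (F : Set AnyGraph.{u}) : ℕ∞ :=
  ⨆ X ∈ F, paramIndex P X

/-- The subdivision of `K_{1,3}` in which the three edges are replaced by paths with `m 0`, `m 1`,
`m 2` edges. The centre is `none`, and `some ⟨i, j⟩` is the vertex of the `i`-th path at distance
`j + 1` from the centre. -/
def subdividedClaw (m : Fin 3 → ℕ) : SimpleGraph (Option (Σ i : Fin 3, Fin (m i))) :=
  SimpleGraph.fromRel fun x y =>
    match x, y with
    | none, some ⟨_, j⟩ => j.val = 0
    | some ⟨i, j⟩, some ⟨i', j'⟩ => i = i' ∧ j'.val = j.val + 1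
    | _, none => False

/-- The number of leaves (vertices of degree 1) adjacent to the centre. -/
noncomputable def centreLeaves (m : Fin 3 → ℕ) : ℕ :=
  {w | (subdividedClaw m).Adj none w ∧ ((subdividedClaw m).neighborSet w).ncard = 1}.ncard

/-- `G` is a subdivision of `K_{1,3}` whose three paths at the centre have `m 0`, `m 1`, `m 2`
edges. -/
def IsClawSubdivision (X : AnyGraph.{u}) (m : Fin 3 → ℕ) : Prop :=
  (∀ i, 1 ≤ m i) ∧ Nonempty (X.2 ≃g subdividedClaw m)

/-- Type A: the centre is adjacent to exactly two leaves. -/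
def IsTypeA (X : AnyGraph.{u}) (m : Fin 3 → ℕ) : Prop :=
  IsClawSubdivision X m ∧ centreLeaves m = 2

/-- Type B: the centre is adjacent to exactly one leaf. -/
def IsTypeB (X : AnyGraph.{u}) (m : Fin 3 → ℕ) : Prop :=
  IsClawSubdivision X m ∧ centreLeaves m = 1

/-!
The edges of a connected graph `G` can be assigned to their end vertices so that all vertices but at
most one receive an even number of edges: as long as two vertices receive an odd number, shift the
edges along a path between them. Pairing the edges received by each vertex gives
`μ(L(G)) = ⌊|E(G)| / 2⌋`. So with `n r = |V(L^r(G))|` we have `μ(L^r(G)) = ⌊n r / 2⌋` for `r ≥ 1`,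
while `μ(G) ≤ ⌊n 0 / 2⌋`, and everything reduces to the growth of `n`.

The second difference `n (r + 2) - 2 n (r + 1) + n r` is the sum over the vertices of `L^r(G)`, with
degrees `d`, of `d (d - 1) / 2 - d + 1 ≥ 0`. If `G` is prolific and not a subdivided claw, this
gives `n 3 ≥ n 0 + 2` and hence index at most `3`. For a subdivided claw with `ℓ ≤ 2` leaves at the
centre, `n 1 = n 2 = n 0 - 1`, `n 3 = n 0 + 2 - ℓ` and `n 4 ≥ n 0 + 5 - 2 ℓ`, so the index is at
most `4`, with equality iff `⌊n 3 / 2⌋ ≤ μ(G)`. For odd `n 0` this means `ℓ = 2`. For even `n 0` it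
means that `ℓ ≥ 1` and `G` has a perfect matching; the latter holds iff all arms but one have even
length, which excludes `ℓ = 2`.
-/

open SimpleGraph

universe v

/-! ### Matchings -/

section Matching

variable {V : Type u} {G : SimpleGraph V}

theorem ncard_verts_of_isMatching [Finite V] {M : G.Subgraph} (hM : M.IsMatching) :
    M.verts.ncard = 2 * M.edgeSet.ncard := by
  classical
  have := Fintype.ofFinite V
  have hdeg : ∀ v, M.spanningCoe.degree v = if v ∈ M.verts then 1 else 0 := by
    intro v
    rw [Subgraph.degree_spanningCoe]
    split_ifs with hv
    · exact Subgraph.isMatching_iff_forall_degree.1 hM v hv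
    · exact Subgraph.degree_of_notMem_verts hv
  have hsum := M.spanningCoe.sum_degrees_eq_twice_card_edges
  simp only [hdeg, Finset.sum_boole, Nat.cast_id] at hsum
  rw [← M.edgeSet_spanningCoe, ← coe_edgeFinset, Set.ncard_coe_finset, ← hsum,
    ← Set.ncard_coe_finset, Finset.coe_filter_univ]
  rfl

theorem even_ncard_of_adj_closed [Finite V] {M : G.Subgraph} (hM : M.IsMatching) {S : Set V}
    (hS : S ⊆ M.verts) (hclosed : ∀ v ∈ S, ∀ w, M.Adj v w → w ∈ S) : Even S.ncard := by
  have hMS : (M.induce S).IsMatching := by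
    intro v hv
    obtain ⟨w, hvw, huniq⟩ := hM (hS hv)
    exact ⟨w, ⟨hv, hclosed v hv w hvw, hvw⟩, fun w' h => huniq w' h.2.2⟩
  exact ⟨_, (ncard_verts_of_isMatching hMS).trans (two_mul _)⟩

theorem matchingNumber_le_half_card [Finite V] :
    matchingNumber ⟨V, G⟩ ≤ (Nat.card V / 2 : ℕ) := by
  refine iSup_le fun ⟨M, hM⟩ => ?_
  have hverts := ncard_verts_of_isMatching hM
  have hle : M.verts.ncard ≤ Nat.card V := Set.ncard_le_card M.verts
  change M.edgeSet.encard ≤ _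
  rw [← M.edgeSet.toFinite.cast_ncard_eq, Nat.cast_le]
  omega

theorem exists_isPerfectMatching [Finite V] (hV : Even (Nat.card V))
    (h : (Nat.card V / 2 : ℕ) ≤ matchingNumber ⟨V, G⟩) :
    ∃ M : G.Subgraph, M.IsPerfectMatching := by
  have : Nonempty {M : G.Subgraph // M.IsMatching} := ⟨⟨⊥, fun _ hv => hv.elim⟩⟩
  obtain ⟨⟨M, hM⟩, hmax⟩ := ENat.exists_eq_iSup_of_lt_top
    (matchingNumber_le_half_card (G := G).trans_lt (ENat.natCast_lt_top _))
  rw [matchingNumber, ← hmax] at h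
  change _ ≤ M.edgeSet.encard at h
  rw [← M.edgeSet.toFinite.cast_ncard_eq, Nat.cast_le] at h
  have hverts := ncard_verts_of_isMatching hM
  refine ⟨M, hM, Subgraph.isSpanning_iff.2 ((Set.eq_univ_iff_ncard _).2 ?_)⟩
  have hle : M.verts.ncard ≤ Nat.card V := Set.ncard_le_card M.verts
  have := hV.two_dvd
  change M.verts.ncard = Nat.card V
  omega

theorem card_le_matchingNumber {ι : Type*} {a b : ι → V} (hab : (Sum.elim a b).Injective)
    (hadj : ∀ i, G.Adj (a i) (b i)) : ENat.card ι ≤ matchingNumber ⟨V, G⟩ := by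
  let M : G.Subgraph := ⨆ i, G.subgraphOfAdj (hadj i)
  obtain ⟨ha, hb, hdisj⟩ := Sum.elim_injective.1 hab
  have hM : M.IsMatching := by
    refine Subgraph.IsMatching.iSup (fun i => .subgraphOfAdj (hadj i)) fun i j hij => ?_
    simp [support_subgraphOfAdj, ha.eq_iff, hb.eq_iff, hij.symm, hdisj, (hdisj _ _).symm]
  have hedges : M.edgeSet = Set.range fun i => s(a i, b i) := by simp [M]
  have hinj : Function.Injective fun i => s(a i, b i) := by
    intro i j hij
    rcases Sym2.eq_iff.1 hij with h | h
    · exact ha h.1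
    · exact absurd h.1 (hdisj _ _)
  refine le_trans ?_ (le_iSup (fun M : {M : G.Subgraph // M.IsMatching} => M.1.edgeSet.encard)
    ⟨M, hM⟩)
  change _ ≤ M.edgeSet.encard
  rw [hedges, ← Set.image_univ, hinj.encard_image, Set.encard_univ]

theorem matchingNumber_le_of_copy {W : Type v} {H : SimpleGraph W} (f : G.Copy H) :
    matchingNumber ⟨V, G⟩ ≤ matchingNumber ⟨W, H⟩ := by
  refine iSup_le fun ⟨M, hM⟩ => ?_
  refine le_trans ?_ (le_iSup (fun M : {M : H.Subgraph // M.IsMatching} => M.1.edgeSet.encard)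
    ⟨M.map f.toHom, hM.map f.toHom f.injective⟩)
  simp only [Subgraph.edgeSet_map, (Sym2.map.injective f.injective).encard_image, le_refl]

theorem matchingNumber_congr {W : Type v} {H : SimpleGraph W} (e : G ≃g H) :
    matchingNumber ⟨V, G⟩ = matchingNumber ⟨W, H⟩ :=
  (matchingNumber_le_of_copy e.toCopy).antisymm (matchingNumber_le_of_copy e.symm.toCopy)

end Matching

/-! ### Matchings of line graphs -/

section LineGraph

variable {V : Type u} {G : SimpleGraph V}

theorem lineGraph_preconnected (h : G.Preconnected) : G.lineGraph.Preconnected := by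
  have reachable_of_mem : ∀ (a : V) (e e' : G.edgeSet), a ∈ e.1 → a ∈ e'.1 →
      G.lineGraph.Reachable e e' := by
    intro a e e' he he'
    by_cases hee : e = e'
    · rw [hee]
    · exact Adj.reachable ⟨hee, a, he, he'⟩
  have reachable_of_walk : ∀ {a b : V} (_ : G.Walk a b) (e e' : G.edgeSet), a ∈ e.1 → b ∈ e'.1 →
      G.lineGraph.Reachable e e' := by
    intro a b p
    induction p with
    | nil => exact reachable_of_mem _
    | @cons a c b hac _ ih =>
      intro e e' he he'
      exact (reachable_of_mem a e ⟨s(a, c), hac⟩ he (Sym2.mem_mk_left a c)).trans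
        (ih _ e' (Sym2.mem_mk_right a c) he')
  intro e e'
  exact reachable_of_walk (h e.1.out.1 e'.1.out.1).some e e' (Sym2.out_fst_mem _)
    (Sym2.out_fst_mem _)

theorem sum_half_card_fiber_le_matchingNumber [Finite V] {ι : Type*} [Fintype ι] {f : V → ι}
    (hf : ∀ v w, f v = f w → v ≠ w → G.Adj v w) :
    ((∑ i, Nat.card {v // f v = i} / 2 : ℕ) : ℕ∞) ≤ matchingNumber ⟨V, G⟩ := by
  let φ : (Σ i, Fin (Nat.card {v // f v = i})) ≃ V :=
    (Equiv.sigmaCongrRight fun i => (Finite.equivFin _).symm).trans (Equiv.sigmaFiberEquiv f)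
  have hφ : ∀ x, f (φ x) = x.1 := fun x => ((Finite.equivFin {v // f v = x.1}).symm x.2).2
  let pair (δ : Fin 2) (x : Σ i, Fin (Nat.card {v // f v = i} / 2)) :
      Σ i, Fin (Nat.card {v // f v = i}) := ⟨x.1, 2 * x.2 + δ, by omega⟩
  have hpair : ∀ δ δ' x x', pair δ x = pair δ' x' → δ = δ' ∧ x = x' := by
    rintro δ δ' ⟨i, k⟩ ⟨i', k'⟩ h
    obtain ⟨rfl, h⟩ := Sigma.mk.inj h
    have := Fin.ext_iff.1 (eq_of_heq h)
    dsimp only at this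
    obtain rfl : δ = δ' := by omega
    obtain rfl : k = k' := by omega
    exact ⟨rfl, rfl⟩
  have hne : ∀ x x', pair 0 x ≠ pair 1 x' := fun x x' h => zero_ne_one (hpair _ _ _ _ h).1
  have hle := card_le_matchingNumber (G := G) (a := φ ∘ pair 0) (b := φ ∘ pair 1)
    (Sum.elim_injective.2 ⟨φ.injective.comp fun x x' h => (hpair _ _ _ _ h).2,
      φ.injective.comp fun x x' h => (hpair _ _ _ _ h).2, fun x x' => φ.injective.ne (hne x x')⟩)
    fun x => hf _ _ ((hφ (pair 0 x)).trans (hφ (pair 1 x)).symm) (φ.injective.ne (hne x x))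
  simpa [ENat.card_eq_coe_fintype_card] using hle

section EndParities

variable [Fintype G.edgeSet] [DecidableEq V]

variable (G) in
/-- The vectors of fibre parities of the maps that send every edge to one of its end vertices. -/
def endParities : Set (V → ZMod 2) :=
  {x | ∃ f : G.edgeSet → V, (∀ e, f e ∈ e.1) ∧ x = ∑ e, Pi.single (f e) 1}

theorem add_single_add_single_mem_endParities_of_adj {a b : V} (hab : G.Adj a b) {x : V → ZMod 2}
    (hx : x ∈ endParities G) : x + Pi.single a 1 + Pi.single b 1 ∈ endParities G := by
  obtain ⟨f, hf, rfl⟩ := hx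
  wlog hfa : f ⟨s(a, b), hab⟩ = a generalizing a b
  · rw [add_right_comm]
    refine this hab.symm ?_
    simpa [Sym2.eq_swap, hfa] using hf ⟨s(a, b), hab⟩
  refine ⟨Function.update f ⟨s(a, b), hab⟩ b, fun e => ?_, ?_⟩
  · rcases eq_or_ne e ⟨s(a, b), hab⟩ with rfl | he
    · simp
    · simpa [he] using hf e
  · have key : ∀ e, (Pi.single (Function.update f ⟨s(a, b), hab⟩ b e) 1 : V → ZMod 2) =
        Pi.single (f e) 1 + if e = ⟨s(a, b), hab⟩ then Pi.single a 1 + Pi.single b 1 else 0 := by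
      intro e
      split_ifs with he
      · rw [he, Function.update_self, hfa, ← add_assoc, ← Pi.single_add, CharTwo.add_self_eq_zero,
          Pi.single_zero, zero_add]
      · rw [Function.update_of_ne he, add_zero]
    simp [key, Finset.sum_add_distrib, add_assoc]

theorem add_single_add_single_mem_endParities {a b : V} (hab : G.Reachable a b) {x : V → ZMod 2}
    (hx : x ∈ endParities G) : x + Pi.single a 1 + Pi.single b 1 ∈ endParities G := by
  obtain ⟨p⟩ := hab
  induction p generalizing x with
  | nil => rwa [add_assoc, ← Pi.single_add, CharTwo.add_self_eq_zero, Pi.single_zero, add_zero]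
  | @cons a c b hac _ ih =>
    have h := ih (add_single_add_single_mem_endParities_of_adj hac hx)
    rwa [add_assoc (x + _) (Pi.single c 1), ← Pi.single_add, CharTwo.add_self_eq_zero,
      Pi.single_zero, add_zero] at h

theorem exists_mem_endParities_subsingleton [Finite V] (h : G.Preconnected) :
    ∃ x ∈ endParities G, {v | x v ≠ 0}.Subsingleton := by
  have hne : (endParities G).Nonempty :=
    ⟨_, fun e => e.1.out.1, fun e => Sym2.out_fst_mem _, rfl⟩
  obtain ⟨x, hx, hmin⟩ :=
    Set.exists_min_image _ (fun x => {v | x v ≠ 0}.ncard) (Set.toFinite _) hne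
  refine ⟨x, hx, fun a ha b hb => ?_⟩
  by_contra hab
  refine (hmin _ (add_single_add_single_mem_endParities (h a b) hx)).not_gt
    (Set.ncard_lt_ncard (Set.ssubset_iff_of_subset ?_ |>.2 ⟨a, ha, ?_⟩))
  · intro v hv
    rcases eq_or_ne v a with rfl | hva
    · exact ha
    rcases eq_or_ne v b with rfl | hvb
    · exact hb
    simpa [hva, hvb] using hv
  · have hxa : x a = 1 := (Fin.exists_fin_two.1 ⟨x a, rfl⟩).resolve_left ha
    simp [hxa, hab, CharTwo.add_self_eq_zero]

end EndParities

theorem half_card_edgeSet_le_matchingNumber_lineGraph [Finite V] (h : G.Preconnected) :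
    ((Nat.card G.edgeSet / 2 : ℕ) : ℕ∞) ≤ matchingNumber ⟨G.edgeSet, G.lineGraph⟩ := by
  classical
  have := Fintype.ofFinite V
  obtain ⟨_, ⟨f, hf, rfl⟩, hodd⟩ := exists_mem_endParities_subsingleton h
  have hfibre : ∀ v, (∑ e, Pi.single (f e) 1 : V → ZMod 2) v = Nat.card {e // f e = v} := by
    intro v
    simp [Finset.sum_apply, Pi.single_apply, Fintype.card_subtype, eq_comm]
  refine le_trans (Nat.cast_le.2 ?_) (sum_half_card_fiber_le_matchingNumber (f := f)
    fun e e' hee hne => ⟨hne, f e, hf e, hee ▸ hf e'⟩)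
  have hcard : ∑ v, Nat.card {e // f e = v} = Nat.card G.edgeSet := by
    rw [← Nat.card_sigma, Nat.card_congr (Equiv.sigmaFiberEquiv f)]
  have hmod : ∑ v, Nat.card {e // f e = v} % 2 ≤ 1 := calc
    _ = ∑ v, if Odd (Nat.card {e // f e = v}) then 1 else 0 :=
      Finset.sum_congr rfl fun v _ => by split_ifs <;> grind
    _ = ({v | Odd (Nat.card {e // f e = v})} : Finset V).card := by simp
    _ ≤ 1 := Finset.card_le_one.2 fun a ha b hb => hodd
      (by simpa [-Finset.sum_apply, hfibre, ZMod.natCast_ne_zero_iff_odd] using ha)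
      (by simpa [-Finset.sum_apply, hfibre, ZMod.natCast_ne_zero_iff_odd] using hb)
  have hdiv : ∑ v, Nat.card {e // f e = v} = 2 * ∑ v, Nat.card {e // f e = v} / 2 +
      ∑ v, Nat.card {e // f e = v} % 2 := by
    rw [Finset.mul_sum, ← Finset.sum_add_distrib]
    exact Finset.sum_congr rfl fun v _ => (Nat.div_add_mod _ 2).symm
  omega

end LineGraph

/-! ### The order of the second line graph -/

/-- The degree of a vertex as a cardinality of a set, which needs no finiteness instance. -/
noncomputable def ndegree {V : Type*} (G : SimpleGraph V) (v : V) : ℕ := (G.neighborSet v).ncard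

/-- The summand that a vertex of degree `d` contributes to `|E(L(G))| - 2 |E(G)| + |V(G)|`. The
subtraction never truncates. -/
def excess (d : ℕ) : ℕ := d.choose 2 + 1 - d

theorem two_mul_le_choose_two_add_three (d : ℕ) : 2 * d ≤ d.choose 2 + 3 := by
  induction d with
  | zero => simp
  | succ d ih =>
    have hchoose : (d + 1).choose 2 = d + d.choose 2 := by simp [Nat.choose_succ_succ' d 1]
    omega

theorem excess_add_self (d : ℕ) : excess d + d = d.choose 2 + 1 := by
  have := two_mul_le_choose_two_add_three d
  rcases le_or_gt d 1 with hd | hd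
  · interval_cases d <;> rfl
  · unfold excess
    omega

theorem le_excess_add_two (d : ℕ) : d ≤ excess d + 2 := by
  have := two_mul_le_choose_two_add_three d
  have := excess_add_self d
  omega

section Counting

variable {V : Type*} {G : SimpleGraph V}

theorem ndegree_eq_degree (v : V) [Fintype (G.neighborSet v)] : ndegree G v = G.degree v := by
  rw [ndegree, Set.ncard_eq_toFinset_card', degree, neighborFinset]

theorem ndegree_congr {W : Type*} {H : SimpleGraph W} (e : G ≃g H) (v : V) :
    ndegree H (e v) = ndegree G v :=
  (Nat.card_congr (e.mapNeighborSet v)).symm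

theorem ncard_incidenceSet (v : V) : (G.incidenceSet v).ncard = ndegree G v := by
  classical
  exact Nat.card_congr (G.incidenceSetEquivNeighborSet v)

theorem sum_ndegree [Fintype V] : ∑ v, ndegree G v = 2 * Nat.card G.edgeSet := by
  classical
  rw [Nat.card_eq_fintype_card, ← edgeFinset_card, ← sum_degrees_eq_twice_card_edges]
  exact Finset.sum_congr rfl fun v _ => ndegree_eq_degree v

theorem ndegree_lineGraph [Finite V] {a b : V} (h : G.Adj a b) :
    ndegree G.lineGraph ⟨s(a, b), h⟩ + 2 = ndegree G a + ndegree G b := by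
  have himage : Subtype.val '' (G.lineGraph.neighborSet ⟨s(a, b), h⟩) =
      (G.incidenceSet a \ {s(a, b)}) ∪ (G.incidenceSet b \ {s(a, b)}) := by
    ext e
    simp only [Set.mem_image, mem_neighborSet, lineGraph_adj_iff_exists, Subtype.exists,
      Set.mem_union, Set.mem_sdiff, incidenceSet, Set.mem_ofPred_eq, Set.mem_singleton_iff,
      Sym2.mem_iff, or_and_right, exists_or]
    grind
  have hdisj : Disjoint (G.incidenceSet a \ {s(a, b)}) (G.incidenceSet b \ {s(a, b)}) := by
    rw [Set.disjoint_left]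
    rintro e ⟨⟨_, ha⟩, hne⟩ ⟨⟨_, hb⟩, _⟩
    exact hne ((Sym2.mem_and_mem_iff h.ne).1 ⟨ha, hb⟩)
  have hcard : ∀ c ∈ s(a, b), (G.incidenceSet c \ {s(a, b)}).ncard + 1 = ndegree G c :=
    fun c hc => (Set.ncard_sdiff_singleton_add_one (s := G.incidenceSet c) ⟨h, hc⟩).trans
      (ncard_incidenceSet c)
  rw [← hcard a (Sym2.mem_mk_left a b), ← hcard b (Sym2.mem_mk_right a b), ndegree,
    ← Set.ncard_image_of_injective _ Subtype.val_injective, himage, Set.ncard_union_eq hdisj]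
  omega

theorem sum_ndegree_lineGraph [Fintype V] [Fintype G.edgeSet] :
    ∑ e, ndegree G.lineGraph e + 2 * Nat.card G.edgeSet = ∑ v, ndegree G v ^ 2 := by
  classical
  calc ∑ e, ndegree G.lineGraph e + 2 * Nat.card G.edgeSet
      = ∑ e : G.edgeSet, (ndegree G.lineGraph e + 2) := by
        simp [Finset.sum_add_distrib, mul_comm]
    _ = ∑ e : G.edgeSet, ∑ v, if v ∈ e.1 then ndegree G v else 0 := by
        refine Finset.sum_congr rfl ?_
        rintro ⟨⟨a, b⟩, hab⟩ -
        have hab' : ({v | v ∈ s(a, b)} : Finset V) = {a, b} := by ext; simp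
        exact (ndegree_lineGraph hab).trans
          (by rw [← Finset.sum_filter, hab', Finset.sum_pair (G.ne_of_adj hab)])
    _ = ∑ v, ∑ e : G.edgeSet, if v ∈ e.1 then ndegree G v else 0 := Finset.sum_comm
    _ = ∑ v, ndegree G v ^ 2 := by
        refine Finset.sum_congr rfl fun v _ => ?_
        have hv : Nat.card {e : G.edgeSet // v ∈ e.1} = ndegree G v := by
          rw [← ncard_incidenceSet]
          exact Nat.card_congr (Equiv.subtypeSubtypeEquivSubtypeInter (· ∈ G.edgeSet) (v ∈ ·))
        simp [← Finset.sum_filter, ← Fintype.card_subtype, ← Nat.card_eq_fintype_card, hv, sq]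

theorem card_edgeSet_lineGraph [Fintype V] :
    Nat.card G.lineGraph.edgeSet = ∑ v, (ndegree G v).choose 2 := by
  classical
  have hsq : ∑ v, ndegree G v ^ 2 = 2 * ∑ v, (ndegree G v).choose 2 + ∑ v, ndegree G v := by
    rw [Finset.mul_sum, ← Finset.sum_add_distrib]
    refine Finset.sum_congr rfl fun v _ => ?_
    rw [Nat.choose_two_right, Nat.mul_div_cancel' (Nat.even_mul_pred_self _).two_dvd,
      Nat.mul_sub_one, Nat.sub_add_cancel (Nat.le_mul_self _), sq]
  rw [← sum_ndegree_lineGraph, sum_ndegree, sum_ndegree] at hsq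
  omega

/-- The sum of the excesses of the vertices, the second difference of the sequence
`|V(G)|, |V(L(G))|, |V(L(L(G)))|`. -/
noncomputable def totalExcess (G : SimpleGraph V) : ℕ := ∑ᶠ v, excess (ndegree G v)

theorem totalExcess_eq_sum [Fintype V] : totalExcess G = ∑ v, excess (ndegree G v) :=
  finsum_eq_sum_of_fintype _

theorem card_edgeSet_lineGraph_add_card [Finite V] :
    Nat.card G.lineGraph.edgeSet + Nat.card V = 2 * Nat.card G.edgeSet + totalExcess G := by
  have := Fintype.ofFinite V
  have hsum : ∑ v, (excess (ndegree G v) + ndegree G v) = ∑ v, ((ndegree G v).choose 2 + 1) :=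
    Finset.sum_congr rfl fun v _ => excess_add_self _
  simp only [Finset.sum_add_distrib, sum_ndegree, ← totalExcess_eq_sum, ← card_edgeSet_lineGraph,
    Finset.sum_const, Finset.card_univ, smul_eq_mul, mul_one, ← Nat.card_eq_fintype_card] at hsum
  omega

theorem ndegree_le_totalExcess_add_two [Finite V] (v : V) : ndegree G v ≤ totalExcess G + 2 := by
  have := Fintype.ofFinite V
  have hexcess := Finset.single_le_sum_of_canonicallyOrdered
    (f := fun v => excess (ndegree G v)) (Finset.mem_univ v)
  rw [← totalExcess_eq_sum] at hexcess
  exact (le_excess_add_two _).trans (Nat.add_le_add_right hexcess 2)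

theorem ndegree_add_ndegree_le_totalExcess_add_four [Finite V] {v w : V} (hvw : v ≠ w) :
    ndegree G v + ndegree G w ≤ totalExcess G + 4 := by
  classical
  have := Fintype.ofFinite V
  have hexcess := Finset.sum_le_sum_of_subset (f := fun v => excess (ndegree G v))
    (Finset.subset_univ {v, w})
  rw [Finset.sum_pair hvw, ← totalExcess_eq_sum] at hexcess
  have hv := le_excess_add_two (ndegree G v)
  have hw := le_excess_add_two (ndegree G w)
  omega

theorem exists_three_le_ndegree_of_card_lt [Finite V] (h : Nat.card V < Nat.card G.edgeSet) :
    ∃ v, 3 ≤ ndegree G v := by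
  have := Fintype.ofFinite V
  by_contra! hdeg
  have hsum : ∑ v, ndegree G v ≤ ∑ _v : V, 2 :=
    Finset.sum_le_sum fun v _ => Nat.le_of_lt_succ (hdeg v)
  simp only [sum_ndegree, Finset.sum_const, Finset.card_univ, smul_eq_mul,
    ← Nat.card_eq_fintype_card] at hsum
  omega

end Counting

/-! ### Subdivided claws -/

section Claw

variable {m : Fin 3 → ℕ}

theorem subdividedClaw_adj_none_some {i : Fin 3} {j : Fin (m i)} :
    (subdividedClaw m).Adj none (some ⟨i, j⟩) ↔ j.val = 0 := by
  simp [subdividedClaw]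

theorem subdividedClaw_adj_some_some {i i' : Fin 3} {j : Fin (m i)} {j' : Fin (m i')} :
    (subdividedClaw m).Adj (some ⟨i, j⟩) (some ⟨i', j'⟩) ↔
      i = i' ∧ (j'.val = j.val + 1 ∨ j.val = j'.val + 1) := by
  simp only [subdividedClaw, fromRel_adj]
  constructor
  · rintro ⟨_, ⟨h, h'⟩ | ⟨h, h'⟩⟩
    exacts [⟨h, Or.inl h'⟩, ⟨h.symm, Or.inr h'⟩]
  · rintro ⟨rfl, h⟩
    refine ⟨fun heq => ?_, h.imp (⟨rfl, ·⟩) (⟨rfl, ·⟩)⟩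
    simp only [Option.some.injEq, Sigma.mk.injEq, heq_eq_eq, true_and] at heq
    subst heq
    omega

/-- The neighbour of a vertex of an arm on the side of the centre. -/
def clawParent (x : Σ i : Fin 3, Fin (m i)) : Option (Σ i : Fin 3, Fin (m i)) :=
  if x.2.val = 0 then none else some ⟨x.1, ⟨x.2.val - 1, by omega⟩⟩

theorem clawParent_eq_none {x : Σ i : Fin 3, Fin (m i)} : clawParent x = none ↔ x.2.val = 0 := by
  simp [clawParent]

theorem clawParent_eq_some {i i' : Fin 3} {j : Fin (m i)} {j' : Fin (m i')} :
    clawParent ⟨i, j⟩ = some ⟨i', j'⟩ ↔ i = i' ∧ j.val = j'.val + 1 := by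
  unfold clawParent
  split_ifs with h
  · simp only [false_iff, not_and]
    dsimp only at h
    omega
  · simp only [Option.some.injEq, Sigma.mk.injEq]
    refine and_congr_right ?_
    rintro rfl
    simp only [heq_eq_eq, Fin.ext_iff]
    dsimp only at h
    omega

theorem subdividedClaw_adj_iff {a b : Option (Σ i : Fin 3, Fin (m i))} :
    (subdividedClaw m).Adj a b ↔
      (∃ x, clawParent x = a ∧ some x = b) ∨ ∃ x, clawParent x = b ∧ some x = a := by
  rcases a with _ | ⟨i, j⟩ <;> rcases b with _ | ⟨i', j'⟩
  · simp
  · simp [clawParent_eq_none, subdividedClaw_adj_none_some]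
  · simp [clawParent_eq_none, adj_comm _ _ none, subdividedClaw_adj_none_some]
  · simp only [subdividedClaw_adj_some_some, Option.some.injEq, exists_eq_right,
      clawParent_eq_some]
    grind

theorem subdividedClaw_adj_clawParent (x : Σ i : Fin 3, Fin (m i)) :
    (subdividedClaw m).Adj (clawParent x) (some x) :=
  subdividedClaw_adj_iff.2 (.inl ⟨x, rfl, rfl⟩)

theorem subdividedClaw_connected : (subdividedClaw m).Connected := by
  have reachable_none : ∀ (n : ℕ) (i : Fin 3) (h : n < m i),
      (subdividedClaw m).Reachable none (some ⟨i, ⟨n, h⟩⟩) := by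
    intro n i h
    induction n with
    | zero => exact (subdividedClaw_adj_none_some.2 rfl).reachable
    | succ n ih =>
      exact (ih (by omega)).trans (subdividedClaw_adj_some_some.2 ⟨rfl, .inl rfl⟩).reachable
  rw [connected_iff_exists_forall_reachable]
  refine ⟨none, ?_⟩
  rintro (_ | ⟨i, j⟩)
  exacts [.rfl, reachable_none j i j.isLt]

/-- Every edge of a subdivided claw joins exactly one vertex of an arm to its parent. -/
noncomputable def clawEdgeEquiv (m : Fin 3 → ℕ) :
    (Σ i : Fin 3, Fin (m i)) ≃ (subdividedClaw m).edgeSet := by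
  refine Equiv.ofBijective
    (fun x => ⟨s(clawParent x, some x), subdividedClaw_adj_clawParent x⟩) ⟨?_, ?_⟩
  · rintro ⟨i, j⟩ ⟨i', j'⟩ h
    rcases Sym2.eq_iff.1 (congrArg Subtype.val h) with ⟨_, h⟩ | ⟨h, h'⟩
    · exact Option.some_injective _ h
    · have := (clawParent_eq_some.1 h).2
      have := (clawParent_eq_some.1 h'.symm).2
      omega
  · rintro ⟨⟨a, b⟩, hab⟩
    rcases subdividedClaw_adj_iff.1 hab with ⟨x, rfl, rfl⟩ | ⟨x, rfl, rfl⟩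
    exacts [⟨x, rfl⟩, ⟨x, Subtype.ext Sym2.eq_swap⟩]

theorem card_subdividedClaw_vert (m : Fin 3 → ℕ) :
    Nat.card (Option (Σ i : Fin 3, Fin (m i))) = ∑ i, m i + 1 := by
  simp

theorem card_edgeSet_subdividedClaw : Nat.card (subdividedClaw m).edgeSet = ∑ i, m i := by
  simp [← Nat.card_congr (clawEdgeEquiv m)]

theorem ndegree_subdividedClaw_none (hm : ∀ i, 1 ≤ m i) : ndegree (subdividedClaw m) none = 3 := by
  have hrange : (subdividedClaw m).neighborSet none =
      Set.range fun i : Fin 3 => some ⟨i, ⟨0, hm i⟩⟩ := by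
    ext w
    rcases w with _ | ⟨i, j⟩
    · simp
    · rw [mem_neighborSet, subdividedClaw_adj_none_some]
      constructor
      · exact fun h => ⟨i, by simp [Fin.ext_iff, h]⟩
      · rintro ⟨i', h⟩
        obtain ⟨rfl, h⟩ := Sigma.mk.inj (Option.some_injective _ h)
        exact congrArg Fin.val (eq_of_heq h).symm
  rw [ndegree, hrange, ← Nat.card_coe_set_eq, Nat.card_range_of_injective, Nat.card_fin]
  exact fun i i' h => congrArg Sigma.fst (Option.some_injective _ h)

theorem ndegree_subdividedClaw_some (x : Σ i : Fin 3, Fin (m i)) :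
    ndegree (subdividedClaw m) (some x) = if x.2.val + 1 < m x.1 then 2 else 1 := by
  obtain ⟨i, j⟩ := x
  have hchild : ∀ w, (subdividedClaw m).Adj (some ⟨i, j⟩) w ↔ w = clawParent ⟨i, j⟩ ∨
      ∃ h : j.val + 1 < m i, w = some ⟨i, ⟨j.val + 1, h⟩⟩ := by
    intro w
    rw [subdividedClaw_adj_iff, or_comm]
    refine or_congr (by simp [eq_comm]) ⟨?_, ?_⟩
    · rintro ⟨⟨i', j'⟩, hparent, rfl⟩
      obtain ⟨rfl, hj⟩ := clawParent_eq_some.1 hparent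
      exact ⟨hj ▸ j'.isLt, by simp [← hj]⟩
    · rintro ⟨h, rfl⟩
      exact ⟨_, clawParent_eq_some.2 ⟨rfl, rfl⟩, rfl⟩
  dsimp only
  split_ifs with h
  · have hset : (subdividedClaw m).neighborSet (some ⟨i, j⟩) =
        {clawParent ⟨i, j⟩, some ⟨i, ⟨j.val + 1, h⟩⟩} := by
      ext w
      simp [hchild, h]
    rw [ndegree, hset, Set.ncard_pair]
    exact fun heq => by grind [clawParent_eq_some.1 heq]
  · have hset : (subdividedClaw m).neighborSet (some ⟨i, j⟩) = {clawParent ⟨i, j⟩} := by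
      ext w
      simp [hchild, h]
    rw [ndegree, hset, Set.ncard_singleton]

theorem totalExcess_subdividedClaw (hm : ∀ i, 1 ≤ m i) : totalExcess (subdividedClaw m) = 1 := by
  rw [totalExcess_eq_sum, Fintype.sum_option, ndegree_subdividedClaw_none hm,
    Finset.sum_eq_zero fun x _ => ?_]
  · rfl
  · rw [ndegree_subdividedClaw_some]
    split_ifs <;> rfl

theorem ndegree_lineGraph_clawEdgeEquiv (hm : ∀ i, 1 ≤ m i) (x : Σ i : Fin 3, Fin (m i)) :
    ndegree (subdividedClaw m).lineGraph (clawEdgeEquiv m x) =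
      (if x.2.val = 0 then 2 else 1) + if x.2.val + 1 < m x.1 then 1 else 0 := by
  have hparent : ndegree (subdividedClaw m) (clawParent x) = if x.2.val = 0 then 3 else 2 := by
    unfold clawParent
    split_ifs with h
    · exact ndegree_subdividedClaw_none hm
    · rw [ndegree_subdividedClaw_some, if_pos]
      dsimp only
      omega
  have hedge := ndegree_lineGraph (subdividedClaw_adj_clawParent x)
  rw [hparent, ndegree_subdividedClaw_some] at hedge
  change ndegree (subdividedClaw m).lineGraph
    ⟨s(clawParent x, some x), subdividedClaw_adj_clawParent x⟩ = _
  split_ifs at hedge ⊢ <;> omega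

theorem totalExcess_lineGraph_subdividedClaw (hm : ∀ i, 1 ≤ m i) :
    totalExcess (subdividedClaw m).lineGraph = {i | m i ≠ 1}.ncard := by
  classical
  have harm : ∀ i, ∑ j : Fin (m i),
      excess (ndegree (subdividedClaw m).lineGraph (clawEdgeEquiv m ⟨i, j⟩)) =
        if m i ≠ 1 then 1 else 0 := by
    intro i
    have := hm i
    rw [Finset.sum_eq_single (⟨0, hm i⟩ : Fin (m i)) (fun j _ hj => ?_) (by simp),
      ndegree_lineGraph_clawEdgeEquiv hm]
    · dsimp only
      split_ifs <;> first | rfl | omega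
    · have hj : j.val ≠ 0 := fun h => hj (Fin.ext h)
      rw [ndegree_lineGraph_clawEdgeEquiv hm, if_neg hj]
      split_ifs <;> rfl
  rw [totalExcess, ← finsum_comp_equiv (clawEdgeEquiv m), finsum_eq_sum_of_fintype,
    Fintype.sum_sigma, Finset.sum_congr rfl fun i _ => harm i, Finset.sum_boole,
    Set.ncard_eq_toFinset_card', Set.toFinset_ofPred, Nat.cast_id]

theorem centreLeaves_eq_ncard (hm : ∀ i, 1 ≤ m i) : centreLeaves m = {i | m i = 1}.ncard := by
  have himage : {w | (subdividedClaw m).Adj none w ∧ ndegree (subdividedClaw m) w = 1} =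
      (fun i : Fin 3 => some ⟨i, ⟨0, hm i⟩⟩) '' {i | m i = 1} := by
    ext w
    constructor
    · rintro ⟨hadj, hleaf⟩
      rcases w with _ | ⟨i, j⟩
      · exact (SimpleGraph.irrefl _ hadj).elim
      · rw [subdividedClaw_adj_none_some] at hadj
        have := hm i
        rw [ndegree_subdividedClaw_some] at hleaf
        have hi : m i = 1 := by grind
        exact ⟨i, hi, by simp [Fin.ext_iff, hadj]⟩
    · rintro ⟨i, hi, rfl⟩
      rw [Set.mem_ofPred_eq] at hi
      exact ⟨subdividedClaw_adj_none_some.2 rfl, by simp [ndegree_subdividedClaw_some, hi]⟩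
  exact (congrArg Set.ncard himage).trans (Set.ncard_image_of_injective _
    fun i i' h => congrArg Sigma.fst (Option.some_injective _ h))

theorem centreLeaves_add_totalExcess_lineGraph (hm : ∀ i, 1 ≤ m i) :
    centreLeaves m + totalExcess (subdividedClaw m).lineGraph = 3 := by
  rw [centreLeaves_eq_ncard hm, totalExcess_lineGraph_subdividedClaw hm]
  exact (Set.ncard_add_ncard_compl {i | m i = 1}).trans (Nat.card_fin 3)

end Claw

/-! ### Recognising paths, cycles and subdivided claws -/

section Structure

variable {V W : Type*} {G : SimpleGraph V} {H : SimpleGraph W}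

theorem surjective_of_adj_closed [Nonempty W] (hG : G.Preconnected) {f : W → V}
    (hf : ∀ x y, G.Adj (f x) y → y ∈ Set.range f) : f.Surjective := by
  intro v
  obtain ⟨p⟩ := hG (f (Classical.arbitrary W)) v
  by_contra hv
  obtain ⟨d, _, ⟨x, hx⟩, hd⟩ := p.exists_boundary_dart (Set.range f) ⟨_, rfl⟩ hv
  exact hd (hf x _ (hx ▸ d.adj))

theorem exists_adj_of_ndegree_le [Finite V] (φ : Copy H G) {x : W} {y : V}
    (hdeg : ndegree G (φ x) ≤ ndegree H x) (hy : G.Adj (φ x) y) : ∃ z, H.Adj x z ∧ φ z = y := by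
  have himage : φ '' H.neighborSet x = G.neighborSet (φ x) := by
    refine Set.eq_of_subset_of_ncard_le (Set.image_subset_iff.2 fun z hz => φ.toHom.map_adj hz) ?_
    exact hdeg.trans (Set.ncard_image_of_injective _ φ.injective).ge
  exact himage.ge hy

theorem nonempty_iso_of_ndegree_le [Finite V] [Nonempty W] (hG : G.Preconnected) (φ : Copy H G)
    (hdeg : ∀ x, ndegree G (φ x) ≤ ndegree H x) : Nonempty (G ≃g H) := by
  have hsurj : Function.Surjective φ := surjective_of_adj_closed hG fun x y hy => by
    obtain ⟨z, _, hz⟩ := exists_adj_of_ndegree_le φ (hdeg x) hy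
    exact ⟨z, hz⟩
  refine ⟨Iso.symm ⟨Equiv.ofBijective φ ⟨φ.injective, hsurj⟩, fun {x z} => ⟨fun h => ?_, fun h =>
    φ.toHom.map_adj h⟩⟩⟩
  obtain ⟨z', hz', heq⟩ := exists_adj_of_ndegree_le φ (hdeg x) h
  rwa [← φ.injective heq]

theorem nonempty_iso_of_isTree (hG : G.IsTree) (hH : H.Connected) (φ : Copy H G)
    (hclosed : ∀ x y, G.Adj (φ x) y → y ∈ Set.range φ) : Nonempty (G ≃g H) := by
  have := hH.nonempty
  let e : W ≃ V := Equiv.ofBijective φ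
    ⟨φ.injective, surjective_of_adj_closed hG.connected.preconnected hclosed⟩
  let e' : H ≃g H.map e.toEmbedding := Iso.map e H
  have hle : H.map e.toEmbedding ≤ G :=
    (map_le_iff_le_comap e.toEmbedding H G).2 fun x y h => φ.toHom.map_adj h
  have heq : H.map e.toEmbedding = G := hle.antisymm
    ((isTree_iff_minimal_connected.1 hG).le_of_le (e'.connected_iff.1 hH) hle)
  exact ⟨heq ▸ e'.symm⟩

theorem ndegree_cycleGraph {n : ℕ} (hn : 3 ≤ n) (v : Fin n) : ndegree (cycleGraph n) v = 2 := by
  obtain ⟨n, rfl⟩ := Nat.exists_eq_add_of_le' hn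
  rw [ndegree_eq_degree, cycleGraph_degree_three_le]

theorem two_le_ndegree_pathGraph {n : ℕ} {i : Fin n} (h0 : i.val ≠ 0) (hn : i.val + 1 < n) :
    2 ≤ ndegree (pathGraph n) i := by
  let pred : Fin n := ⟨i.val - 1, by omega⟩
  let succ : Fin n := ⟨i.val + 1, hn⟩
  have hsub : {pred, succ} ⊆ (pathGraph n).neighborSet i :=
    Set.pair_subset (pathGraph_adj.2 (.inr (Nat.succ_pred h0))) (pathGraph_adj.2 (.inl rfl))
  rw [← Set.ncard_pair (a := pred) (b := succ)
    (Fin.ne_of_val_ne (by dsimp only [pred, succ]; omega))]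
  exact Set.ncard_le_ncard hsub

theorem exists_iso_cycleGraph [Finite V] (hG : G.Preconnected) (hcycle : ¬ G.IsAcyclic)
    (hdeg : ∀ v, ndegree G v ≤ 2) : ∃ n, 3 ≤ n ∧ Nonempty (G ≃g cycleGraph n) := by
  rw [isAcyclic_iff_free_cycleGraph] at hcycle
  push Not at hcycle
  obtain ⟨n, hn, ⟨φ⟩⟩ := hcycle
  have : Nonempty (Fin n) := ⟨⟨0, by omega⟩⟩
  exact ⟨n, hn, nonempty_iso_of_ndegree_le hG φ fun x => (ndegree_cycleGraph hn x).symm ▸ hdeg _⟩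

theorem exists_iso_pathGraph [Finite V] (hG : G.IsTree) (hdeg : ∀ v, ndegree G v ≤ 2) :
    ∃ n, Nonempty (G ≃g pathGraph n) := by
  classical
  have := hG.connected.nonempty
  obtain ⟨a, b, p, hp, hmax⟩ := Walk.exists_isPath_forall_isPath_length_le_length G
  have happly : ∀ i, hp.pathGraphCopy i = p.getVert i.val :=
    fun i => p.support_getElem_eq_getVert _
  have hrange : ∀ v ∈ p.support, v ∈ Set.range hp.pathGraphCopy := by
    intro v hv
    obtain ⟨i, rfl, hi⟩ := Walk.mem_support_iff_exists_getVert.1 hv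
    exact ⟨⟨i, Nat.lt_succ_of_le hi⟩, happly _⟩
  refine ⟨_, nonempty_iso_of_isTree hG (pathGraph_connected _) hp.pathGraphCopy fun i y hy => ?_⟩
  by_cases h0 : i.val = 0
  · by_contra hout
    rw [happly, h0, p.getVert_zero] at hy
    have := hmax _ _ _ (hp.cons (h := hy.symm) fun hmem => hout (hrange y hmem))
    simp at this
  by_cases hn : i.val + 1 < p.length + 1
  · obtain ⟨z, -, hz⟩ := exists_adj_of_ndegree_le hp.pathGraphCopy
      ((hdeg _).trans (two_le_ndegree_pathGraph h0 hn)) hy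
    exact ⟨z, hz⟩
  · by_contra hout
    rw [happly, p.getVert_of_length_le (by omega)] at hy
    have := hmax _ _ _ (hp.concat (fun hmem => hout (hrange y hmem)) hy)
    simp at this

end Structure

section ClawGrowth

variable {V : Type*} {G : SimpleGraph V} {m : Fin 3 → ℕ}

theorem exists_copy_of_adj_clawParent {f : Option (Σ i : Fin 3, Fin (m i)) → V}
    (hinj : f.Injective) (hadj : ∀ x, G.Adj (f (clawParent x)) (f (some x))) :
    ∃ φ : Copy (subdividedClaw m) G, φ none = f none := by
  refine ⟨Hom.toCopy ⟨f, fun {a b} hab => ?_⟩ hinj, rfl⟩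
  rcases subdividedClaw_adj_iff.1 hab with ⟨x, rfl, rfl⟩ | ⟨x, rfl, rfl⟩
  exacts [hadj x, (hadj x).symm]

theorem exists_copy_subdividedClaw_one [Finite V] {c : V} (hc : ndegree G c = 3) :
    ∃ φ : Copy (subdividedClaw fun _ => 1) G, φ none = c := by
  let e : G.neighborSet c ≃ Fin 3 := Finite.equivFinOfCardEq hc
  let f : Option (Σ _ : Fin 3, Fin 1) → V := fun x => x.elim c fun y => e.symm y.1
  have hne : ∀ y, f (some y) ≠ c := fun y => (e.symm y.1).2.ne'
  refine exists_copy_of_adj_clawParent (f := f) ?_ fun x => ?_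
  · rintro (_ | ⟨i, j⟩) (_ | ⟨i', j'⟩) h
    · rfl
    · exact absurd h.symm (hne _)
    · exact absurd h (hne _)
    · obtain rfl := e.symm.injective (Subtype.ext h)
      rw [Subsingleton.elim j j']
  · rw [clawParent_eq_none.2 (by omega)]
    exact (e.symm x.1).2

/-- The extension of a map of the vertices of a subdivided claw with arms `m` to arms `m'`, sending
all new vertices to `y`. -/
def clawExtend (f : Option (Σ i : Fin 3, Fin (m i)) → V) (y : V) {m' : Fin 3 → ℕ} :
    Option (Σ i : Fin 3, Fin (m' i)) → V
  | none => f none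
  | some z => if h : z.2.val < m z.1 then f (some ⟨z.1, ⟨z.2.val, h⟩⟩) else y

theorem clawExtend_injective {f : Option (Σ i : Fin 3, Fin (m i)) → V} (hf : f.Injective) {y : V}
    (hy : y ∉ Set.range f) {m' : Fin 3 → ℕ}
    (hnew : ∀ z z' : Σ i : Fin 3, Fin (m' i), m z.1 ≤ z.2 → m z'.1 ≤ z'.2 → z = z') :
    (clawExtend f y : Option (Σ i : Fin 3, Fin (m' i)) → V).Injective := by
  have hne : ∀ a, f a ≠ y := fun a h => hy ⟨a, h⟩
  rintro (_ | ⟨i, j⟩) (_ | ⟨i', j'⟩) h <;> simp only [clawExtend] at h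
  · rfl
  · split_ifs at h
    exacts [by simpa using hf h, absurd h (hne _)]
  · split_ifs at h
    exacts [by simpa using hf h, absurd h.symm (hne _)]
  · split_ifs at h with hj hj' hj'
    · obtain ⟨rfl, hjj⟩ := Sigma.mk.inj (Option.some_injective _ (hf h))
      rw [Fin.ext (Fin.mk.inj (eq_of_heq hjj))]
    · exact absurd h (hne _)
    · exact absurd h.symm (hne _)
    · exact congrArg some (hnew ⟨i, j⟩ ⟨i', j'⟩ (not_lt.1 hj) (not_lt.1 hj'))

theorem exists_copy_subdividedClaw_update (φ : Copy (subdividedClaw m) G) {i : Fin 3}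
    {j : Fin (m i)} (hj : j.val + 1 = m i) {y : V} (hadj : G.Adj (φ (some ⟨i, j⟩)) y)
    (hy : y ∉ Set.range φ) :
    ∃ ψ : Copy (subdividedClaw (Function.update m i (m i + 1))) G, ψ none = φ none := by
  set m' := Function.update m i (m i + 1) with hm'
  have hi : m' i = m i + 1 := Function.update_self ..
  have hne : ∀ k ≠ i, m' k = m k := fun k hk => Function.update_of_ne hk ..
  have hnew : ∀ k (l : Fin (m' k)), m k ≤ l → k = i ∧ l.val = m i := by
    intro k l h
    have := l.isLt
    by_cases hk : k = i
    · subst hk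
      omega
    · have := hne k hk
      omega
  refine exists_copy_of_adj_clawParent (f := clawExtend φ y)
    (clawExtend_injective φ.injective hy ?_) ?_
  · rintro ⟨k, l⟩ ⟨k', l'⟩ h h'
    obtain ⟨rfl, hl⟩ := hnew k l h
    obtain ⟨rfl, hl'⟩ := hnew k' l' h'
    rw [Fin.ext (hl.trans hl'.symm)]
  · rintro ⟨k, l⟩
    by_cases h : l.val < m k
    · have hφ : clawExtend φ y (clawParent ⟨k, l⟩) = φ (clawParent ⟨k, ⟨l, h⟩⟩) := by
        unfold clawParent
        split_ifs
        exacts [rfl, dif_pos _]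
      rw [hφ, clawExtend, dif_pos h]
      exact φ.toHom.map_adj (subdividedClaw_adj_clawParent _)
    · obtain ⟨rfl, _⟩ := hnew k l (not_lt.1 h)
      have hparent : clawParent ⟨k, l⟩ = some ⟨k, ⟨j, by omega⟩⟩ :=
        clawParent_eq_some.2 ⟨rfl, by dsimp only; omega⟩
      rwa [hparent, clawExtend, clawExtend, dif_pos j.isLt, dif_neg h]

theorem exists_iso_subdividedClaw [Finite V] (hG : G.IsTree) {c : V} (hc : ndegree G c = 3)
    (hdeg : ∀ v ≠ c, ndegree G v ≤ 2) :
    ∃ m : Fin 3 → ℕ, (∀ i, 1 ≤ m i) ∧ Nonempty (G ≃g subdividedClaw m) := by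
  let S : Set (Fin 3 → ℕ) :=
    {m | (∀ i, 1 ≤ m i) ∧ ∃ φ : Copy (subdividedClaw m) G, φ none = c}
  have hS : S.Finite := by
    refine (Set.finite_Iic fun _ => Nat.card V).subset ?_
    rintro m ⟨-, φ, -⟩ i
    have hcard := Nat.card_le_card_of_injective φ φ.injective
    rw [card_subdividedClaw_vert] at hcard
    exact (Finset.single_le_sum (fun _ _ => Nat.zero_le _) (Finset.mem_univ i)).trans
      (Nat.le_of_succ_le hcard)
  obtain ⟨m, ⟨hm, φ, hφ⟩, hmax⟩ :=
    hS.exists_maximal ⟨_, fun _ => le_rfl, exists_copy_subdividedClaw_one hc⟩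
  refine ⟨m, hm, nonempty_iso_of_isTree hG subdividedClaw_connected φ fun x y hy => ?_⟩
  have hclosed : ndegree G (φ x) ≤ ndegree (subdividedClaw m) x → y ∈ Set.range φ := fun h =>
    (exists_adj_of_ndegree_le φ h hy).imp fun _ => And.right
  rcases x with _ | ⟨i, j⟩
  · exact hclosed (by rw [hφ, hc, ndegree_subdividedClaw_none hm])
  have hdeg' := hdeg _ (hφ ▸ φ.injective.ne (Option.some_ne_none _) : φ (some ⟨i, j⟩) ≠ c)
  rw [ndegree_subdividedClaw_some] at hclosed
  by_cases hj : j.val + 1 < m i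
  · exact hclosed (by rwa [if_pos hj])
  by_contra hout
  obtain ⟨ψ, hψ⟩ :=
    exists_copy_subdividedClaw_update φ (Nat.le_antisymm j.isLt (not_lt.1 hj)) hy hout
  have hle : m ≤ Function.update m i (m i + 1) :=
    le_update_iff.2 ⟨Nat.le_succ _, fun _ _ => le_rfl⟩
  have hi := hmax ⟨fun k => (hm k).trans (hle k), ψ, hψ.trans hφ⟩ hle i
  rw [Function.update_self] at hi
  exact Nat.not_succ_le_self _ hi

end ClawGrowth

/-! ### Matchings of subdivided claws -/

section ClawMatching

variable {m : Fin 3 → ℕ}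

theorem exists_forall_ne_even_of_isPerfectMatching {M : (subdividedClaw m).Subgraph}
    (hM : M.IsPerfectMatching) : ∃ i₀, ∀ i ≠ i₀, Even (m i) := by
  obtain ⟨w, hw, -⟩ := hM.1 (hM.2 none)
  obtain ⟨⟨i₀, j₀⟩, rfl⟩ := Option.ne_none_iff_exists'.1 hw.adj_sub.ne'
  refine ⟨i₀, fun i hi => ?_⟩
  let arm : Fin (m i) → Option (Σ i : Fin 3, Fin (m i)) := fun j => some ⟨i, j⟩
  have harm : arm.Injective := fun j j' h => by simpa [arm] using h
  have heven := even_ncard_of_adj_closed hM.1 (S := Set.range arm) (fun v _ => hM.2 v) ?_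
  · rwa [← Set.image_univ, Set.ncard_image_of_injective _ harm, Set.ncard_univ, Nat.card_fin]
      at heven
  · rintro _ ⟨j, rfl⟩ (_ | ⟨i', j'⟩) hadj
    · have hpartner := hM.1.eq_of_adj_left hadj.symm hw
      exact absurd (congrArg Sigma.fst (Option.some_injective _ hpartner)) hi
    · obtain ⟨rfl, -⟩ := subdividedClaw_adj_some_some.1 hadj.adj_sub
      exact ⟨j', rfl⟩

theorem sum_half_le_matchingNumber_subdividedClaw (m : Fin 3 → ℕ) (i₀ : Fin 3) :
    ((∑ i, (m i + if i = i₀ then 1 else 0) / 2 : ℕ) : ℕ∞) ≤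
      matchingNumber ⟨_, subdividedClaw m⟩ := by
  let δ (i : Fin 3) : ℕ := if i = i₀ then 1 else 0
  have : ∀ i, δ i = if i = i₀ then 1 else 0 := fun _ => rfl
  let child (x : Σ i, Fin ((m i + δ i) / 2)) : Σ i, Fin (m i) :=
    ⟨x.1, ⟨2 * x.2 + 1 - δ x.1, by grind⟩⟩
  have hle := card_le_matchingNumber (G := subdividedClaw m) (a := fun x => clawParent (child x))
    (b := fun x => some (child x)) (Sum.elim_injective.2 ⟨?_, ?_, ?_⟩)
    fun x => subdividedClaw_adj_clawParent _
  · simpa [ENat.card_eq_coe_fintype_card] using hle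
  · rintro ⟨i, k⟩ ⟨i', k'⟩ h
    dsimp only at h
    rcases hp : clawParent (child ⟨i', k'⟩) with _ | ⟨i'', j⟩ <;> rw [hp] at h
    · have hk := clawParent_eq_none.1 h
      have hk' := clawParent_eq_none.1 hp
      obtain rfl : i = i' := by grind
      have hkk' : k = k' := Fin.ext (by grind)
      rw [hkk']
    · obtain ⟨rfl, hk⟩ := clawParent_eq_some.1 h
      obtain ⟨rfl, hk'⟩ := clawParent_eq_some.1 hp
      grind
  · rintro ⟨i, k⟩ ⟨i', k'⟩ h
    obtain ⟨rfl, hk⟩ := Sigma.mk.inj (Option.some_injective _ h)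
    have := Fin.mk.inj (eq_of_heq hk)
    grind
  · rintro ⟨i, k⟩ ⟨i', k'⟩ h
    obtain ⟨rfl, hk⟩ := clawParent_eq_some.1 h
    dsimp only at hk
    grind

end ClawMatching

/-- The reordering of the arms of a subdivided claw. -/
def clawPermIso (m : Fin 3 → ℕ) (π : Equiv.Perm (Fin 3)) :
    subdividedClaw (m ∘ π) ≃g subdividedClaw m where
  toEquiv := Equiv.optionCongr (Equiv.sigmaCongrLeft (β := fun i => Fin (m i)) π)
  map_rel_iff' := by
    rintro (_ | ⟨i, j⟩) (_ | ⟨i', j'⟩)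
    · simp
    · exact subdividedClaw_adj_none_some.trans
        (subdividedClaw_adj_none_some (m := m ∘ π) (i := i') (j := j')).symm
    · rw [adj_comm, adj_comm (subdividedClaw (m ∘ π))]
      exact subdividedClaw_adj_none_some.trans
        (subdividedClaw_adj_none_some (m := m ∘ π) (i := i) (j := j)).symm
    · refine subdividedClaw_adj_some_some.trans (Iff.trans ?_ subdividedClaw_adj_some_some.symm)
      exact and_congr π.injective.eq_iff Iff.rfl

theorem exists_perm_antitone_comp (m : Fin 3 → ℕ) : ∃ π : Equiv.Perm (Fin 3), Antitone (m ∘ π) :=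
  ⟨Fin.revPerm.trans (Tuple.sort m), (Tuple.monotone_sort m).comp_antitone Fin.rev_anti⟩

theorem nonempty_iso_star_of_forall_eq_one {m : Fin 3 → ℕ} (hm : ∀ i, m i = 1) :
    Nonempty (subdividedClaw m ≃g completeBipartiteGraph (Fin 1) (Fin 3)) := by
  obtain rfl : m = fun _ => 1 := funext hm
  refine ⟨⟨⟨fun x => x.elim (Sum.inl 0) fun y => Sum.inr y.1,
    Sum.elim (fun _ => none) fun i => some ⟨i, 0⟩, ?_, ?_⟩, ?_⟩⟩
  · rintro (_ | ⟨i, j⟩)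
    · rfl
    · simp [Subsingleton.elim j 0]
  · rintro (i | i)
    · simp [Subsingleton.elim i 0]
    · rfl
  · rintro (_ | ⟨i, j⟩) (_ | ⟨i', j'⟩)
    · simp
    · simp [subdividedClaw_adj_none_some]
    · simp [adj_comm _ (some _) none, subdividedClaw_adj_none_some]
    · simp [subdividedClaw_adj_some_some]

/-! ### Iterated line graphs -/

section Index

variable {V : Type u} {W : Type v} {G : SimpleGraph V} {H : SimpleGraph W}

theorem paramIndex_le {P : AnyGraph.{u} → ℕ∞} {X : AnyGraph.{u}} {r : ℕ}
    (h : P X < P (AnyGraph.iterLine r X)) : paramIndex P X ≤ r :=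
  iInf₂_le r h

theorem le_paramIndex_iff {P : AnyGraph.{u} → ℕ∞} {X : AnyGraph.{u}} {k : ℕ} :
    (k : ℕ∞) ≤ paramIndex P X ↔ ∀ r < k, P (AnyGraph.iterLine r X) ≤ P X := by
  simp only [paramIndex, le_iInf_iff, Nat.cast_le]
  exact forall_congr' fun r => by rw [← not_lt, ← not_lt, imp_not_comm]

theorem nonempty_iso_iterLine (e : G ≃g H) (r : ℕ) :
    Nonempty ((AnyGraph.iterLine r ⟨V, G⟩).2 ≃g (AnyGraph.iterLine r ⟨W, H⟩).2) := by
  induction r with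
  | zero => exact ⟨e⟩
  | succ r ih => exact ih.map Iso.lineGraph

theorem paramIndex_matchingNumber_congr (e : G ≃g H) :
    paramIndex matchingNumber ⟨V, G⟩ = paramIndex matchingNumber ⟨W, H⟩ := by
  have hiter : ∀ r, matchingNumber (AnyGraph.iterLine r ⟨V, G⟩) =
      matchingNumber (AnyGraph.iterLine r ⟨W, H⟩) :=
    fun r => matchingNumber_congr (nonempty_iso_iterLine e r).some
  simp only [paramIndex, hiter, matchingNumber_congr e]

theorem finite_iterLine [Finite V] (r : ℕ) : Finite (AnyGraph.iterLine r ⟨V, G⟩).1 := by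
  induction r with
  | zero => assumption
  | succ r ih => exact Subtype.finite

theorem iterLine_preconnected (hG : G.Preconnected) (r : ℕ) :
    (AnyGraph.iterLine r ⟨V, G⟩).2.Preconnected := by
  induction r with
  | zero => exact hG
  | succ r ih => exact lineGraph_preconnected ih

/-- The number of vertices of `L^r(G)`. -/
noncomputable def iterLineOrder (G : SimpleGraph V) (r : ℕ) : ℕ :=
  Nat.card (AnyGraph.iterLine r ⟨V, G⟩).1

theorem iterLineOrder_add_two [Finite V] (r : ℕ) :
    iterLineOrder G (r + 2) + iterLineOrder G r =
      2 * iterLineOrder G (r + 1) + totalExcess (AnyGraph.iterLine r ⟨V, G⟩).2 :=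
  have := finite_iterLine (G := G) r
  card_edgeSet_lineGraph_add_card

theorem matchingNumber_iterLine_succ [Finite V] (hG : G.Preconnected) (r : ℕ) :
    matchingNumber (AnyGraph.iterLine (r + 1) ⟨V, G⟩) = (iterLineOrder G (r + 1) / 2 : ℕ) :=
  have := finite_iterLine (G := G) r
  le_antisymm matchingNumber_le_half_card
    (half_card_edgeSet_le_matchingNumber_lineGraph (iterLine_preconnected hG r))

theorem paramIndex_le_of_matchingNumber_lt [Finite V] (hG : G.Preconnected) {r : ℕ}
    (h : matchingNumber ⟨V, G⟩ < (iterLineOrder G (r + 1) / 2 : ℕ)) :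
    paramIndex matchingNumber ⟨V, G⟩ ≤ (r + 1 : ℕ) :=
  paramIndex_le (by rwa [matchingNumber_iterLine_succ hG])

theorem paramIndex_le_of_half_card_lt [Finite V] (hG : G.Preconnected) {r : ℕ}
    (h : Nat.card V / 2 < iterLineOrder G (r + 1) / 2) :
    paramIndex matchingNumber ⟨V, G⟩ ≤ (r + 1 : ℕ) :=
  paramIndex_le_of_matchingNumber_lt hG
    (matchingNumber_le_half_card.trans_lt (Nat.cast_lt.2 h))

theorem four_le_paramIndex_iff [Finite V] (hG : G.Preconnected)
    (h13 : iterLineOrder G 1 ≤ iterLineOrder G 3) (h23 : iterLineOrder G 2 ≤ iterLineOrder G 3) :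
    4 ≤ paramIndex matchingNumber ⟨V, G⟩ ↔
      (iterLineOrder G 3 / 2 : ℕ) ≤ matchingNumber ⟨V, G⟩ := by
  have hmono : ∀ {a b : ℕ}, a ≤ b → ((a / 2 : ℕ) : ℕ∞) ≤ (b / 2 : ℕ) := fun h =>
    Nat.cast_le.2 (Nat.div_le_div_right h)
  rw [show (4 : ℕ∞) = (4 : ℕ) from rfl, le_paramIndex_iff, ← matchingNumber_iterLine_succ hG 2]
  refine ⟨fun h => h 3 (by decide), fun h r hr => ?_⟩
  rw [matchingNumber_iterLine_succ hG] at h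
  interval_cases r
  · exact le_rfl
  · exact (matchingNumber_iterLine_succ hG 0).trans_le ((hmono h13).trans h)
  · exact (matchingNumber_iterLine_succ hG 1).trans_le ((hmono h23).trans h)
  · exact (matchingNumber_iterLine_succ hG 2).trans_le h

end Index

section ClawIndex

variable {m : Fin 3 → ℕ}

theorem centreLeaves_eq_sum (hm : ∀ i, 1 ≤ m i) :
    centreLeaves m = ∑ i, if m i = 1 then 1 else 0 := by
  rw [centreLeaves_eq_ncard hm, Set.ncard_eq_toFinset_card', Set.toFinset_ofPred,
    Finset.card_filter]

theorem iterLineOrder_subdividedClaw (hm : ∀ i, 1 ≤ m i) :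
    iterLineOrder (subdividedClaw m) 1 = ∑ i, m i ∧ iterLineOrder (subdividedClaw m) 2 = ∑ i, m i ∧
      iterLineOrder (subdividedClaw m) 3 + centreLeaves m = ∑ i, m i + 3 := by
  have h1 : iterLineOrder (subdividedClaw m) 1 = ∑ i, m i := card_edgeSet_subdividedClaw
  have h2 : iterLineOrder (subdividedClaw m) 2 + Nat.card (Option (Σ i : Fin 3, Fin (m i))) =
      2 * iterLineOrder (subdividedClaw m) 1 + totalExcess (subdividedClaw m) :=
    iterLineOrder_add_two 0
  have h3 : iterLineOrder (subdividedClaw m) 3 + iterLineOrder (subdividedClaw m) 1 =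
      2 * iterLineOrder (subdividedClaw m) 2 + totalExcess (subdividedClaw m).lineGraph :=
    iterLineOrder_add_two 1
  rw [card_subdividedClaw_vert, totalExcess_subdividedClaw hm] at h2
  have hleaves := centreLeaves_add_totalExcess_lineGraph hm
  omega

theorem exists_forall_ne_even_of_half_card_le (h : Even (∑ i, m i + 1))
    (hμ : ((∑ i, m i + 1) / 2 : ℕ) ≤ matchingNumber ⟨_, subdividedClaw m⟩) :
    ∃ i₀, ∀ i ≠ i₀, Even (m i) := by
  rw [← card_subdividedClaw_vert] at h hμ
  obtain ⟨M, hM⟩ := exists_isPerfectMatching h hμ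
  exact exists_forall_ne_even_of_isPerfectMatching hM

theorem centreLeaves_le_one_of_forall_ne_even (hm : ∀ i, 1 ≤ m i) {i₀ : Fin 3}
    (h : ∀ i ≠ i₀, Even (m i)) : centreLeaves m ≤ 1 := by
  rw [centreLeaves_eq_ncard hm, Set.ncard_le_one_iff]
  have hleaf : ∀ i, m i = 1 → i = i₀ := fun i hi => by
    by_contra hne
    exact Nat.not_even_one (hi ▸ h i hne)
  exact fun _ _ ha hb => (hleaf _ ha).trans (hleaf _ hb).symm

theorem matchingNumber_subdividedClaw_le (m : Fin 3 → ℕ) :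
    matchingNumber ⟨_, subdividedClaw m⟩ ≤ ((∑ i, m i + 1) / 2 : ℕ) := by
  rw [← card_subdividedClaw_vert]
  exact matchingNumber_le_half_card

theorem paramIndex_subdividedClaw_le (hm : ∀ i, 1 ≤ m i) (hleaves : centreLeaves m ≤ 2) :
    paramIndex matchingNumber ⟨_, subdividedClaw m⟩ ≤ 4 := by
  refine paramIndex_le_of_matchingNumber_lt (r := 3) subdividedClaw_connected.preconnected ?_
  by_contra! hμ
  obtain ⟨-, h2, h3⟩ := iterLineOrder_subdividedClaw hm
  have h4 : 2 * iterLineOrder (subdividedClaw m) 3 ≤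
      iterLineOrder (subdividedClaw m) 4 + iterLineOrder (subdividedClaw m) 2 :=
    (Nat.le_add_right _ _).trans_eq (iterLineOrder_add_two 2).symm
  have hle := Nat.cast_le.1 (hμ.trans (matchingNumber_subdividedClaw_le m))
  simp only [Nat.reduceAdd] at hμ hle
  have heven : Even (∑ i, m i + 1) := Nat.even_iff.2 (by omega)
  obtain ⟨i₀, hi₀⟩ := exists_forall_ne_even_of_half_card_le heven
    ((Nat.cast_le.2 (by omega)).trans hμ)
  have := centreLeaves_le_one_of_forall_ne_even hm hi₀
  omega

theorem paramIndex_subdividedClaw_eq_four_iff_le (hm : ∀ i, 1 ≤ m i)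
    (hleaves : centreLeaves m ≤ 2) : paramIndex matchingNumber ⟨_, subdividedClaw m⟩ = 4 ↔
      ((∑ i, m i + 3 - centreLeaves m) / 2 : ℕ) ≤ matchingNumber ⟨_, subdividedClaw m⟩ := by
  obtain ⟨h1, h2, h3⟩ := iterLineOrder_subdividedClaw hm
  rw [← h3, Nat.add_sub_cancel, ← four_le_paramIndex_iff
    subdividedClaw_connected.preconnected (by omega) (by omega)]
  exact ⟨ge_of_eq, (paramIndex_subdividedClaw_le hm hleaves).antisymm⟩

theorem odd_or_even_of_paramIndex_subdividedClaw_eq_four (hm : ∀ i, 1 ≤ m i)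
    (hleaves : centreLeaves m ≤ 2) (h : paramIndex matchingNumber ⟨_, subdividedClaw m⟩ = 4) :
    (Odd (∑ i, m i + 1) ∧ centreLeaves m = 2) ∨
      (Even (∑ i, m i + 1) ∧ centreLeaves m = 1 ∧ ∀ i, m i ≠ 1 → Even (m i)) := by
  rw [paramIndex_subdividedClaw_eq_four_iff_le hm hleaves] at h
  have hle := Nat.cast_le.1 (h.trans (matchingNumber_subdividedClaw_le m))
  rcases Nat.even_or_odd (∑ i, m i + 1) with heven | hodd
  · obtain ⟨i₀, hi₀⟩ := exists_forall_ne_even_of_half_card_le heven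
      ((Nat.cast_le.2 (by omega)).trans h)
    have hle_one := centreLeaves_le_one_of_forall_ne_even hm hi₀
    have hone : centreLeaves m = 1 := by
      rw [Nat.even_iff] at heven
      omega
    refine .inr ⟨heven, hone, fun i hi => hi₀ i ?_⟩
    rintro rfl
    rw [centreLeaves_eq_ncard hm, Set.ncard_eq_one] at hone
    obtain ⟨j, hj⟩ := hone
    have hmj : m j = 1 := hj.ge rfl
    exact Nat.not_even_one (hmj ▸ hi₀ j fun hji => hi (hji ▸ hmj))
  · refine .inl ⟨hodd, ?_⟩
    rw [Nat.odd_iff] at hodd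
    omega

theorem paramIndex_subdividedClaw_eq_four_iff (hm : ∀ i, 1 ≤ m i) (hleaves : centreLeaves m ≤ 2) :
    paramIndex matchingNumber ⟨_, subdividedClaw m⟩ = 4 ↔
      (Odd (∑ i, m i + 1) ∧ centreLeaves m = 2) ∨
      (Even (∑ i, m i + 1) ∧ centreLeaves m = 1 ∧ ∀ i, m i ≠ 1 → Even (m i)) := by
  refine ⟨odd_or_even_of_paramIndex_subdividedClaw_eq_four hm hleaves, fun h => ?_⟩
  rw [paramIndex_subdividedClaw_eq_four_iff_le hm hleaves]
  obtain ⟨i₀, hi₀⟩ : ∃ i₀, m i₀ = 1 := by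
    have hpos : 0 < centreLeaves m := by omega
    rw [centreLeaves_eq_ncard hm] at hpos
    exact Set.nonempty_of_ncard_ne_zero hpos.ne'
  refine (Nat.cast_le.2 ?_).trans (sum_half_le_matchingNumber_subdividedClaw m i₀)
  rw [centreLeaves_eq_sum hm] at h ⊢
  simp only [Fin.sum_univ_three, Nat.odd_iff, Nat.even_iff] at h ⊢
  have := h.imp id fun h => And.intro (h.2.2 0) (And.intro (h.2.2 1) (h.2.2 2))
  fin_cases i₀ <;> grind

end ClawIndex

/-! ### Prolific graphs -/

section Prolific

variable {V : Type u} {G : SimpleGraph V}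

theorem ndegree_pathGraph_le {n : ℕ} (v : Fin n) : ndegree (pathGraph n) v ≤ 2 := by
  by_contra! h
  obtain ⟨a, b, c, ha, hb, hc, hab, hac, hbc⟩ := (Set.two_lt_ncard_iff (Set.toFinite _)).1 h
  rw [mem_neighborSet, pathGraph_adj] at ha hb hc
  omega

theorem IsProlific.exists_three_le_ndegree (hG : IsProlific ⟨V, G⟩) : ∃ v, 3 ≤ ndegree G v := by
  obtain ⟨hfin : Finite V, hconn, hpath, hcycle, -⟩ := hG
  by_contra! hdeg
  replace hdeg : ∀ v, ndegree G v ≤ 2 := fun v => Nat.le_of_lt_succ (hdeg v)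
  by_cases hacyclic : G.IsAcyclic
  · obtain ⟨n, hiso⟩ := exists_iso_pathGraph ⟨hconn, hacyclic⟩ hdeg
    exact hpath n hiso
  · obtain ⟨n, hn, hiso⟩ := exists_iso_cycleGraph hconn.preconnected hacyclic hdeg
    exact hcycle n hn hiso

theorem IsProlific.of_three_le_ndegree [Finite V] (hG : G.Connected) {v : V}
    (hv : 3 ≤ ndegree G v) (hcard : Nat.card V ≠ 4) : IsProlific ⟨V, G⟩ := by
  refine ⟨‹_›, hG, fun k ⟨e⟩ => ?_, fun k hk ⟨e⟩ => ?_, fun ⟨e⟩ => hcard ?_⟩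
  · rw [← ndegree_congr e] at hv
    exact absurd (ndegree_pathGraph_le (e v)) (by omega)
  · rw [← ndegree_congr e, ndegree_cycleGraph hk] at hv
    exact absurd hv (by decide)
  · rw [Nat.card_congr e.toEquiv]
    simp

theorem IsProlific.centreLeaves_le_two (hG : IsProlific ⟨V, G⟩) {m : Fin 3 → ℕ}
    (hm : ∀ i, 1 ≤ m i) (e : G ≃g subdividedClaw m) : centreLeaves m ≤ 2 := by
  by_contra! h
  have hone : ∀ i, m i = 1 := by
    rw [centreLeaves_eq_sum hm, Fin.sum_univ_three] at h
    rw [Fin.forall_fin_succ, Fin.forall_fin_two]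
    grind
  exact hG.2.2.2.2 ((nonempty_iso_star_of_forall_eq_one hone).map e.trans)

theorem exists_iso_subdividedClaw_of_totalExcess_le_one [Finite V] (hG : G.IsTree) {c : V}
    (hc : 3 ≤ ndegree G c) (hexcess : totalExcess G ≤ 1) :
    ∃ m, (∀ i, 1 ≤ m i) ∧ Nonempty (G ≃g subdividedClaw m) := by
  have hc_le := ndegree_le_totalExcess_add_two (G := G) c
  refine exists_iso_subdividedClaw hG (c := c) (by omega) fun v hv => ?_
  have := ndegree_add_ndegree_le_totalExcess_add_four (G := G) hv
  omega

theorem IsProlific.card_add_two_le_iterLineOrder_three (hG : IsProlific ⟨V, G⟩)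
    (hclaw : ¬ ∃ m, (∀ i, 1 ≤ m i) ∧ Nonempty (G ≃g subdividedClaw m)) :
    Nat.card V + 2 ≤ iterLineOrder G 3 := by
  have : Finite V := hG.1
  have hconn : G.Connected := hG.2.1
  obtain ⟨c, hc⟩ := hG.exists_three_le_ndegree
  have hc_le := ndegree_le_totalExcess_add_two (G := G) c
  have h2 : Nat.card G.lineGraph.edgeSet + Nat.card V = 2 * Nat.card G.edgeSet + totalExcess G :=
    card_edgeSet_lineGraph_add_card
  have h3 : iterLineOrder G 3 + Nat.card G.edgeSet =
      2 * Nat.card G.lineGraph.edgeSet + totalExcess G.lineGraph := iterLineOrder_add_two 1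
  by_cases hcard : Nat.card V ≤ Nat.card G.edgeSet
  · omega
  have hedges : Nat.card G.edgeSet + 1 = Nat.card V :=
    hconn.card_vert_le_card_edgeSet_add_one.antisymm' (Nat.lt_of_not_le hcard)
  have hexcess : 2 ≤ totalExcess G := by
    by_contra! h
    exact hclaw (exists_iso_subdividedClaw_of_totalExcess_le_one
      (isTree_iff_connected_and_card.2 ⟨hconn, hedges⟩) hc (Nat.le_of_lt_succ h))
  obtain ⟨e, he⟩ := exists_three_le_ndegree_of_card_lt (G := G.lineGraph) (by omega)
  have he_le := ndegree_le_totalExcess_add_two (G := G.lineGraph) e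
  omega

theorem IsProlific.paramIndex_le_three (hG : IsProlific ⟨V, G⟩)
    (hclaw : ¬ ∃ m, (∀ i, 1 ≤ m i) ∧ Nonempty (G ≃g subdividedClaw m)) :
    paramIndex matchingNumber ⟨V, G⟩ ≤ 3 := by
  have : Finite V := hG.1
  have hcard := hG.card_add_two_le_iterLineOrder_three hclaw
  have hlt : Nat.card V / 2 < iterLineOrder G 3 / 2 := by omega
  exact paramIndex_le_of_half_card_lt hG.2.1.preconnected hlt

theorem IsProlific.paramIndex_le_four (hG : IsProlific ⟨V, G⟩) :
    paramIndex matchingNumber ⟨V, G⟩ ≤ 4 := by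
  by_cases hclaw : ∃ m, (∀ i, 1 ≤ m i) ∧ Nonempty (G ≃g subdividedClaw m)
  · obtain ⟨m, hm, ⟨e⟩⟩ := hclaw
    rw [paramIndex_matchingNumber_congr e]
    exact paramIndex_subdividedClaw_le hm (hG.centreLeaves_le_two hm e)
  · exact (hG.paramIndex_le_three hclaw).trans (by decide)

theorem IsProlific.paramIndex_eq_four_iff_of_iso (hG : IsProlific ⟨V, G⟩) {m : Fin 3 → ℕ}
    (hm : ∀ i, 1 ≤ m i) (e : G ≃g subdividedClaw m) :
    paramIndex matchingNumber ⟨V, G⟩ = 4 ↔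
      (Odd (Nat.card V) ∧ centreLeaves m = 2) ∨
      (Even (Nat.card V) ∧ centreLeaves m = 1 ∧ ∀ i, m i ≠ 1 → Even (m i)) := by
  rw [paramIndex_matchingNumber_congr e, Nat.card_congr e.toEquiv, card_subdividedClaw_vert]
  exact paramIndex_subdividedClaw_eq_four_iff hm (hG.centreLeaves_le_two hm e)

theorem exists_antitone_iso_subdividedClaw {m : Fin 3 → ℕ} (hm : ∀ i, 1 ≤ m i)
    (e : G ≃g subdividedClaw m) : ∃ m', Antitone m' ∧ IsClawSubdivision ⟨V, G⟩ m' := by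
  obtain ⟨π, hπ⟩ := exists_perm_antitone_comp m
  exact ⟨m ∘ π, hπ, fun i => hm (π i), ⟨e.trans (clawPermIso m π).symm⟩⟩

theorem lt_and_eq_one_of_centreLeaves_eq_one {m : Fin 3 → ℕ} (hm : ∀ i, 1 ≤ m i)
    (hanti : Antitone m) (h : centreLeaves m = 1) : m 2 < m 1 ∧ m 2 = 1 := by
  have h01 : m 1 ≤ m 0 := hanti (by decide)
  have h12 : m 2 ≤ m 1 := hanti (by decide)
  rw [centreLeaves_eq_sum hm, Fin.sum_univ_three] at h
  grind

theorem IsProlific.paramIndex_eq_four_iff (hG : IsProlific ⟨V, G⟩) :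
    paramIndex matchingNumber ⟨V, G⟩ = 4 ↔
      (Odd (Nat.card V) ∧ ∃ m : Fin 3 → ℕ, IsTypeA ⟨V, G⟩ m) ∨
      (Even (Nat.card V) ∧ ∃ m : Fin 3 → ℕ, IsTypeB ⟨V, G⟩ m ∧
        m 1 ≤ m 0 ∧ m 2 < m 1 ∧ m 2 = 1 ∧ Even (m 0) ∧ Even (m 1)) := by
  constructor
  · intro h
    by_cases hclaw : ∃ m, (∀ i, 1 ≤ m i) ∧ Nonempty (G ≃g subdividedClaw m)
    · obtain ⟨m₀, hm₀, ⟨e₀⟩⟩ := hclaw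
      obtain ⟨m, hanti, hm, ⟨e⟩⟩ := exists_antitone_iso_subdividedClaw hm₀ e₀
      rcases (hG.paramIndex_eq_four_iff_of_iso hm e).1 h with
        ⟨hodd, hleaves⟩ | ⟨heven, hleaves, harms⟩
      · exact .inl ⟨hodd, m, ⟨hm, ⟨e⟩⟩, hleaves⟩
      · obtain ⟨hlt, hone⟩ := lt_and_eq_one_of_centreLeaves_eq_one hm hanti hleaves
        have h10 : m 1 ≤ m 0 := hanti (by decide)
        exact .inr ⟨heven, m, ⟨⟨hm, ⟨e⟩⟩, hleaves⟩, h10, hlt, hone,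
          harms 0 (by omega), harms 1 (by omega)⟩
    · exact absurd (h.ge.trans (hG.paramIndex_le_three hclaw)) (by decide)
  · rintro (⟨hodd, m, ⟨hm, ⟨e⟩⟩, hleaves⟩ |
      ⟨heven, m, ⟨⟨hm, ⟨e⟩⟩, hleaves⟩, -, -, hone, h0, h1⟩)
    · exact (hG.paramIndex_eq_four_iff_of_iso hm e).2 (.inl ⟨hodd, hleaves⟩)
    · refine (hG.paramIndex_eq_four_iff_of_iso hm e).2 (.inr ⟨heven, hleaves, ?_⟩)
      rw [Fin.forall_fin_succ, Fin.forall_fin_two]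
      exact ⟨fun _ => h0, fun _ => h1, fun h => absurd hone h⟩

theorem exists_isProlific_paramIndex_eq_four :
    ∃ X : AnyGraph.{u}, IsProlific X ∧ paramIndex matchingNumber X = 4 := by
  let m : Fin 3 → ℕ := ![2, 1, 1]
  have hm : ∀ i, 1 ≤ m i := by decide
  let e := Iso.comap (Equiv.ulift.{u} (α := Option (Σ i : Fin 3, Fin (m i)))) (subdividedClaw m)
  have hcard := (Nat.card_congr e.toEquiv).trans (card_subdividedClaw_vert m)
  have hdeg : ndegree _ (e.symm none) = 3 :=
    (ndegree_congr e.symm none).trans (ndegree_subdividedClaw_none hm)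
  have hG := IsProlific.of_three_le_ndegree (e.connected_iff.2 subdividedClaw_connected) hdeg.ge
    (by rw [hcard]; decide)
  refine ⟨_, hG, (hG.paramIndex_eq_four_iff_of_iso hm e).2 (.inl ⟨?_, ?_⟩)⟩
  · rw [hcard]
    decide
  · rw [centreLeaves_eq_sum hm]
    rfl

end Prolific

theorem theoremG :
    (∀ (V : Type u) (G : SimpleGraph V), IsProlific ⟨V, G⟩ →
      paramIndex matchingNumber ⟨V, G⟩ ≤ 4 ∧
      (paramIndex matchingNumber ⟨V, G⟩ = 4 ↔
        (Odd (Nat.card V) ∧ ∃ m : Fin 3 → ℕ, IsTypeA ⟨V, G⟩ m) ∨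
        (Even (Nat.card V) ∧ ∃ m : Fin 3 → ℕ, IsTypeB ⟨V, G⟩ m ∧
          m 1 ≤ m 0 ∧ m 2 < m 1 ∧ m 2 = 1 ∧ Even (m 0) ∧ Even (m 1)))) ∧
    familyIndex matchingNumber {X : AnyGraph.{u} | IsProlific X} = 4 := by
  refine ⟨fun V G hG => ⟨hG.paramIndex_le_four, hG.paramIndex_eq_four_iff⟩, le_antisymm ?_ ?_⟩
  · exact iSup₂_le fun X hX => IsProlific.paramIndex_le_four hX
  · obtain ⟨X, hX, h⟩ := exists_isProlific_paramIndex_eq_four.{u}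
    rw [← h]
    exact le_iSup₂ (f := fun (X : AnyGraph.{u}) (_ : X ∈ {X | IsProlific X}) =>
      paramIndex matchingNumber X) X hX
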